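/- Let $q$ be a prime power and let $m,m_1,m_2$ be positive integers with $m_1\mid m$, $m_2\mid m$, $m_2>1$, $\gcd(m_1,m_2)=2$ and $(m_1,m_2)\neq(2,2)$. Let $\operatorname{Tr}_{q^{m_i}/q}:\mathbb F_{q^{m_i}}\to\mathbb F_q$ and $\mathrm N_{q^m/q^{m_i}}:\mathbb F_{q^m}\to\mathbb F_{q^{m_i}}$ be the trace and norm maps, and let $$D=\{x\in\mathbb F_{q^m}^*:\operatorname{Tr}_{q^{m_2}/q}(\mathrm N_{q^m/q^{m_2}}(x))=0\}.$$ Let $D_1=\{d_1,\dots,d_n\}$ (with $n=|D_1|$) be any set with $D=\{uv:u\in\mathbb F_q^*,\ v\in D_1\}$ and $d_i/d_j\notin\mathbb F_q^*$ for all $i\ne j$, that is, a set holding exactly one representative of each $\mathbb F_q^*$-orbit of $D$. Consider the linear code $$\mathcal C_{D_1}=\left\{\left(\operatorname{Tr}_{q^{m_1}/q}(x\,\mathrm N_{q^m/q^{m_1}}(d_1)),\dots,\operatorname{Tr}_{q^{m_1}/q}(x\,\mathrm N_{q^m/q^{m_1}}(d_n))\right):x\in\mathbb F_{q^{m_1}}\right\}\subseteq\mathbb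 F_q^n .$$ Then $\mathcal C_{D_1}$ has length $$n=\frac{(q^m-1)(q^{m_2-1}-1)}{(q^{m_2}-1)(q-1)}$$ and dimension $m_1$ over $\mathbb F_q$. It is a two-weight code (exactly two of the numbers $A_1,\dots,A_n$ are nonzero, where $A_i$ is the number of codewords of Hamming weight $i$), and its weight enumerator is $$\sum_{i=0}^nA_iz^i=1+\frac{q^{m_1}-1}{q+1}\,z^{w_1}+\frac{q(q^{m_1}-1)}{q+1}\,z^{w_2},$$ where $w_1,w_2$ are the integers $$w_1=\frac{q^{m_1-1}(q^m-1)\left(q^{m_2-1}-1-(-1)^{\frac{m_1+m_2}{2}}(q-1)q^{\frac{m_2-m_1}{2}}\right)}{(q^{m_1}-1)(q^{m_2}-1)},$$ $$w_2=\frac{q^{m_1-1}(q^m-1)\left(q^{m_2-1}-1-(-1)^{\frac{m_1+m_2}{2}+1}(q-1)q^{\frac{m_2-m_1}{2}-1}\right)}{(q^{m_1}-1)(q^{m_2}-1)}.$$ -/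

import Mathlib

open Polynomial

noncomputable section

/-- The set `D = {x ∈ K* : Tr_{L₂/F}(N_{K/L₂}(x)) + a = 0}` for a tower of fields `F ⊆ L₂ ⊆ K`. -/
def definingSet (F L₂ K : Type*) [Field F] [Field L₂] [Field K] [Algebra F L₂] [Algebra L₂ K]
    (a : F) : Set K :=
  {x | x ≠ 0 ∧ Algebra.trace F L₂ (Algebra.norm L₂ x) + a = 0}

/-- `D = F* D₁ = {u v : u ∈ F*, v ∈ D₁}`, and the quotient of two distinct elements of `D₁` never
lies in `F*`: the set `D₁` contains exactly one representative of each `F*`-orbit of `D`. -/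
structure IsShortenedSet (F : Type*) {K : Type*} [Field F] [Field K] [Algebra F K]
    (D D₁ : Set K) : Prop where
  eq_smul : D = {x | ∃ u : F, u ≠ 0 ∧ ∃ v ∈ D₁, x = algebraMap F K u * v}
  div_ne : ∀ v ∈ D₁, ∀ w ∈ D₁, v ≠ w → ∀ u : F, u ≠ 0 → v / w ≠ algebraMap F K u

/-- For a list `d = (d₁, …, dₙ)` of elements of `K`, the code
`{(Tr_{L₁/F}(x N_{K/L₁}(d₁)), …, Tr_{L₁/F}(x N_{K/L₁}(dₙ))) : x ∈ L₁}`, a subspace of `Fⁿ`. -/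
def traceNormCode (F L₁ : Type*) {K : Type*} [Field F] [Field L₁] [Field K]
    [Algebra F L₁] [Algebra L₁ K] {n : ℕ} (d : Fin n → K) : Submodule F (Fin n → F) :=
  LinearMap.range (LinearMap.pi fun i =>
    (Algebra.trace F L₁).comp (LinearMap.mulRight F (Algebra.norm L₁ (d i))))

open Classical in
/-- `A_i`: the number of codewords of Hamming weight `i`. -/
def weightCount {F : Type*} [Field F] {n : ℕ} (C : Submodule F (Fin n → F)) (i : ℕ) : ℕ :=
  Set.ncard {c : Fin n → F | c ∈ C ∧ hammingNorm c = i}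

/-- The weight enumerator `A₀ + A₁ z + ⋯ + Aₙ zⁿ` (where `A₀ = 1` for a linear code). -/
def weightEnumerator {F : Type*} [Field F] {n : ℕ} (C : Submodule F (Fin n → F)) : ℚ[X] :=
  ∑ i ∈ Finset.range (n + 1), Polynomial.C (weightCount C i : ℚ) * X ^ i

/-- A code is `t`-weight if exactly `t` of the numbers `A₁, …, Aₙ` are nonzero. -/
def IsTWeight {F : Type*} [Field F] {n : ℕ} (t : ℕ) (C : Submodule F (Fin n → F)) : Prop :=
  ((Finset.Icc 1 n).filter fun i => weightCount C i ≠ 0).card = t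

end

/-! The weight of the codeword of x is n minus the number of representatives y with Tr(x N₁(y)) = 0,
so the task is to count the y ∈ K* with Tr(N₂(y)) = 0 and Tr(x N₁(y)) = 0. The i-th field's
condition is invariant under ((|Lᵢ|-1)/(q-1))-th powers. The half-degrees are coprime, so these
exponents have gcd q+1, and by `card_sq_mul_sum_mul_eq` the joint count depends only on the averages
of each condition over (q+1)-th powers.

Such an average counts the zeros of Tr(a z^(q+1)) on a field of degree 2k. The attached character
sum S(a), a semiprimitive Gauss sum, is found by elementary means. Its square is |L| times the size
of a radical, which is 1 or q², and S(a) ≡ 1 mod q+1 fixes the sign, so S(a) is (-q)^k or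
(-q)^(k+1). Since the S(a) with a ≠ 0 sum to zero, the second value is taken on exactly one coset of
the (q+1)-th powers (`exists_traceFormSum_eq_ite`).

Pulled back to K* along the norms, the exceptional sets of the two fields are cosets of one
subgroup, hence equal or disjoint according to x. This dichotomy gives the two weights, with
frequencies in ratio 1 : q (`exists_card_trace_norm_eq_zero`). -/

/-! ### Power maps and fibres of homomorphisms of finite groups. -/

theorem IsCyclic.exists_pow_eq_of_pow_eq_one {G : Type*} [CommGroup G] [IsCyclic G] [Finite G]
    {d e : ℕ} (hde : d * e = Nat.card G) {y : G} (hy : y ^ e = 1) : ∃ w : G, w ^ d = y := by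
  have hpos : 0 < Nat.card G := Nat.card_pos
  have hd : 0 < d := Nat.pos_of_ne_zero (by rintro rfl; simp at hde; omega)
  have hle : (powMonoidHom d : G →* G).range ≤ (powMonoidHom e : G →* G).ker := by
    rintro _ ⟨w, rfl⟩
    simp [MonoidHom.mem_ker, ← pow_mul, hde]
  -- Both subgroups have exactly e elements.
  have hcard : Nat.card (powMonoidHom e : G →* G).ker ≤ Nat.card (powMonoidHom d : G →* G).range := by
    rw [IsCyclic.card_powMonoidHom_ker, IsCyclic.card_powMonoidHom_range, ← hde,
      Nat.gcd_mul_left_left, Nat.gcd_mul_right_left, Nat.mul_div_cancel_left _ hd]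
  have h := Subgroup.eq_of_le_of_card_ge hle hcard
  have : y ∈ (powMonoidHom d : G →* G).range := by
    rw [h]; exact hy
  exact this

theorem MonoidHom.card_fiber_eq_ite {G H : Type*} [Group G] [Group H] [Fintype G]
    [DecidableEq H] (φ : G →* H) (h : H) [Decidable (h ∈ φ.range)] :
    (Finset.univ.filter fun g => φ g = h).card = if h ∈ φ.range then Nat.card φ.ker else 0 := by
  split_ifs with hr
  · have := MonoidHom.card_fiber_eq_of_mem_range φ (x := h) (y := 1) hr ⟨1, map_one φ⟩
    rw [this]
    exact (Nat.subtype_card _ (by simp [MonoidHom.mem_ker])).symm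
  · rw [Finset.card_eq_zero, Finset.filter_eq_empty_iff]
    exact fun g _ hg => hr ⟨g, hg⟩

theorem MonoidHom.sum_comp_eq {G H : Type*} [Group G] [Group H] [Fintype G] [Fintype H]
    {R : Type*} [CommSemiring R] (φ : G →* H) [DecidablePred (· ∈ φ.range)] (f : H → R) :
    ∑ g, f (φ g) = Nat.card φ.ker * ∑ h with h ∈ φ.range, f h := by
  classical
  rw [← Finset.sum_fiberwise_of_maps_to (t := Finset.univ) (g := φ) (by simp), Finset.mul_sum,
    Finset.sum_filter]
  refine Finset.sum_congr rfl fun h _ => ?_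
  rw [Finset.sum_congr rfl (g := fun _ => f h) (by simp +contextual), Finset.sum_const,
    φ.card_fiber_eq_ite h]
  split_ifs <;> simp

theorem MonoidHom.sum_comp_eq_of_surjective {G H : Type*} [Group G] [Group H] [Fintype G]
    [Fintype H] {R : Type*} [CommSemiring R] (φ : G →* H) (hφ : Function.Surjective φ) (f : H → R) :
    (Nat.card H : R) * ∑ g, f (φ g) = Nat.card G * ∑ h, f h := by
  classical
  have hr : ∀ h, h ∈ φ.range := fun h => hφ h
  have h1 := φ.ker.card_mul_index
  rw [Subgroup.index_ker, MonoidHom.range_eq_top.2 hφ, Subgroup.card_top] at h1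
  rw [φ.sum_comp_eq, ← h1]
  simp only [hr, Finset.filter_true, Nat.cast_mul]
  ring

noncomputable section

open Classical in
theorem sum_eq_zero_add_sum_units {L M : Type*} [DivisionRing L] [Fintype L] [AddCommMonoid M]
    (f : L → M) : ∑ z, f z = f 0 + ∑ z : Lˣ, f z := by
  rw [← Finset.add_sum_erase _ _ (Finset.mem_univ 0)]
  congr 1
  refine (Finset.sum_bij (fun (z : Lˣ) _ => (z : L)) (by simp) (fun _ _ _ _ h => Units.ext h)
    (fun z hz => ?_) (by simp)).symm
  exact ⟨Units.mk0 z (Finset.ne_of_mem_erase hz), by simp, rfl⟩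

/-! ### The form Tr(a z^(q+1)) and its character sum. -/

namespace FiniteField

variable {F L : Type*} [Field F] [Fintype F] [Field L] [Fintype L] [Algebra F L]

local notation "q" => Fintype.card F

theorem card_units_factor {k : ℕ} (hk : Module.finrank F L = 2 * k) :
    ∃ s : ℕ, (q + 1) * ((q - 1) * s) = Nat.card Lˣ ∧ (q - 1) * ((q + 1) * s) = Nat.card Lˣ ∧
      (q ^ 2 - 1) * s = Nat.card Lˣ ∧ 0 < s := by
  have h1 : q ^ 2 - 1 ∣ Nat.card Lˣ := by
    rw [Nat.card_units, Nat.card_eq_fintype_card, Module.card_eq_pow_finrank (K := F) (V := L), hk, pow_mul]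
    simpa using Nat.sub_dvd_pow_sub_pow (q ^ 2) 1 k
  obtain ⟨s, hs⟩ := h1
  have h2 : q ^ 2 - 1 = (q + 1) * (q - 1) := by
    simpa using Nat.sq_sub_sq (q) 1
  have hpos : 0 < Nat.card Lˣ := Nat.card_pos
  refine ⟨s, ?_, ?_, hs.symm, ?_⟩
  · rw [hs, h2]; ring
  · rw [hs, h2]; ring
  · rcases Nat.eq_zero_or_pos s with rfl | h
    · simp only [mul_zero] at hs; omega
    · exact h

theorem units_pow_card_sub_one (t : Fˣ) : t ^ (q - 1) = 1 := by
  have := pow_card_eq_one' (x := t)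
  rwa [Nat.card_units, Nat.card_eq_fintype_card] at this

/-- Nonzero elements of the base field are `(q + 1)`-th powers in an extension of even degree. -/
theorem exists_pow_card_add_one_eq {k : ℕ} (hk : Module.finrank F L = 2 * k) (t : F) (ht : t ≠ 0) :
    ∃ l : L, l ≠ 0 ∧ l ^ (q + 1) = algebraMap F L t := by
  obtain ⟨s, hs, -⟩ := card_units_factor (F := F) (L := L) hk
  have hy : (Units.map (algebraMap F L).toMonoidHom (Units.mk0 t ht)) ^ ((q - 1) * s) = 1 := by
    rw [pow_mul, ← map_pow, units_pow_card_sub_one, map_one, one_pow]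
  obtain ⟨w, hw⟩ := IsCyclic.exists_pow_eq_of_pow_eq_one hs hy
  refine ⟨w, w.ne_zero, ?_⟩
  simpa using congrArg Units.val hw

open Classical in
/-- The number of `z` with `Tr(a z ^ (q + 1)) = t`. -/
def traceFormCount (F : Type*) {L : Type*} [Field F] [Fintype F] [Field L] [Fintype L]
    [Algebra F L] (a : L) (t : F) : ℕ :=
  (Finset.univ.filter fun z : L => Algebra.trace F L (a * z ^ (Fintype.card F + 1)) = t).card

theorem traceFormCount_mul_pow (a : L) (u : L) (hu : u ≠ 0) (t : F) :
    traceFormCount F (a * u ^ (q + 1)) t = traceFormCount F a t := by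
  classical
  refine Finset.card_bijective (fun z => u * z) (mulLeft_bijective₀ u hu) fun z => ?_
  simp [mul_pow, mul_assoc]

/-- The scalar t is itself a (q+1)-th power l^(q+1), so z ↦ l z multiplies the trace by t. Hence two
counts, at 0 and at 1, determine the whole distribution. -/
theorem traceFormCount_eq_one {k : ℕ} (hk : Module.finrank F L = 2 * k) (a : L) (t : F)
    (ht : t ≠ 0) : traceFormCount F a t = traceFormCount F a 1 := by
  classical
  obtain ⟨l, hl, hlt⟩ := exists_pow_card_add_one_eq hk t ht
  rw [← traceFormCount_mul_pow a l hl]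
  refine congrArg Finset.card (Finset.filter_congr fun z _ => ?_)
  rw [hlt, mul_comm a, mul_assoc, ← Algebra.smul_def, map_smul, smul_eq_mul,
    mul_eq_left₀ ht]

theorem sum_traceFormCount {R : Type*} [CommRing R] {k : ℕ} (hk : Module.finrank F L = 2 * k)
    (a : L) (f : F → R) :
    ∑ z : L, f (Algebra.trace F L (a * z ^ (q + 1))) =
      traceFormCount F a 0 * f 0 + traceFormCount F a 1 * (∑ t, f t - f 0) := by
  classical
  rw [← Finset.sum_fiberwise_of_maps_to (t := Finset.univ)
    (g := fun z : L => Algebra.trace F L (a * z ^ (q + 1))) (by simp)]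
  have h (t : F) : ∑ z : L with Algebra.trace F L (a * z ^ (q + 1)) = t,
      f (Algebra.trace F L (a * z ^ (q + 1))) = traceFormCount F a t * f t := by
    rw [Finset.sum_congr rfl (g := fun _ => f t) (by simp +contextual), Finset.sum_const,
      nsmul_eq_mul, traceFormCount]
  simp only [h]
  rw [← Finset.add_sum_erase _ _ (Finset.mem_univ 0), ← Finset.add_sum_erase _ f
    (Finset.mem_univ 0), add_sub_cancel_left, Finset.mul_sum]
  congr 1
  refine Finset.sum_congr rfl fun t ht => ?_
  rw [traceFormCount_eq_one hk a t (Finset.ne_of_mem_erase ht)]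

/-- `Σ_z ψ(Tr(a z ^ (q + 1)))` for a nontrivial additive character `ψ`, as an integer. -/
def traceFormSum (F : Type*) {L : Type*} [Field F] [Fintype F] [Field L] [Fintype L]
    [Algebra F L] (a : L) : ℤ := traceFormCount F a 0 - traceFormCount F a 1

theorem card_mul_traceFormCount_zero {k : ℕ} (hk : Module.finrank F L = 2 * k) (a : L) :
    (q : ℤ) * traceFormCount F a 0 = (q : ℤ) ^ (2 * k) + (q - 1) * traceFormSum F a := by
  have h := sum_traceFormCount (R := ℤ) hk a fun _ => 1
  simp only [Finset.sum_const, Finset.card_univ, nsmul_eq_mul, mul_one,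
    Module.card_eq_pow_finrank (K := F) (V := L), hk] at h
  push_cast at h
  rw [h, traceFormSum]
  ring

theorem traceFormSum_eq_sum {k : ℕ} (hk : Module.finrank F L = 2 * k) (a : L)
    {ψ : AddChar F ℂ} (hψ : ψ ≠ 1) :
    (traceFormSum F a : ℂ) = ∑ z : L, ψ (Algebra.trace F L (a * z ^ (q + 1))) := by
  rw [sum_traceFormCount hk a, AddChar.sum_eq_zero_of_ne_one hψ, AddChar.map_zero_eq_one,
    traceFormSum]
  push_cast
  ring

open Classical in
-- On L* the map z ↦ z^(q+1) has kernel of order q+1, so nonzero solutions come in batches of that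
-- size; the extra 1 is z = 0.
theorem traceFormCount_eq_units (a : L) (t : F) {k : ℕ} (hk : Module.finrank F L = 2 * k) :
    ∃ N : ℕ, traceFormCount F a t = (if t = 0 then 1 else 0) + (q + 1) * N := by
  classical
  obtain ⟨s, hs, -⟩ := card_units_factor (F := F) (L := L) hk
  have h := MonoidHom.sum_comp_eq (powMonoidHom (q + 1) : Lˣ →* Lˣ)
    (fun z : Lˣ => if Algebra.trace F L (a * z) = t then 1 else 0)
  rw [IsCyclic.card_powMonoidHom_ker, ← hs, Nat.gcd_mul_right_left, Nat.cast_id] at h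
  refine ⟨_, Eq.trans ?_ (congrArg (_ + ·) h)⟩
  rw [traceFormCount, Finset.card_filter, sum_eq_zero_add_sum_units]
  congr 1
  · simp [eq_comm]

/-- This congruence will determine the sign once the square is known. -/
theorem traceFormSum_modEq {k : ℕ} (hk : Module.finrank F L = 2 * k) (a : L) :
    ((q : ℤ) + 1) ∣ traceFormSum F a - 1 := by
  obtain ⟨N, hN⟩ := traceFormCount_eq_units a (0 : F) hk
  obtain ⟨N', hN'⟩ := traceFormCount_eq_units a (1 : F) hk
  refine ⟨N - N', ?_⟩
  rw [traceFormSum, hN, hN']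
  simp only [if_true, one_ne_zero, if_false]
  push_cast
  ring

end FiniteField

namespace FiniteField

variable {F L : Type*} [Field F] [Fintype F] [Field L] [Fintype L] [Algebra F L]

local notation "q" => Fintype.card F

theorem algebraTrace_pow_card (x : L) : Algebra.trace F L (x ^ q) = Algebra.trace F L x := by
  simpa using Algebra.trace_eq_of_algEquiv (frobeniusAlgEquivOfAlgebraic F L) x

theorem add_pow_card_base (F : Type*) {L : Type*} [Field F] [Fintype F] [Field L] [Algebra F L]
    (x y : L) : (x + y) ^ Fintype.card F = x ^ Fintype.card F + y ^ Fintype.card F :=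
  map_add (frobeniusAlgHom F L) x y

theorem neg_pow_card_base (F : Type*) {L : Type*} [Field F] [Fintype F] [Field L] [Algebra F L]
    (x : L) : (-x) ^ Fintype.card F = -x ^ Fintype.card F :=
  map_neg (frobeniusAlgHom F L) x

/-- If `x ^ q = -x` then `x` has trace zero to `F` in an extension of even degree. -/
theorem trace_eq_zero_of_pow_card_eq_neg {k : ℕ} (hk : Module.finrank F L = 2 * k) {x : L}
    (hx : x ^ q = -x) : Algebra.trace F L x = 0 := by
  have h (i : ℕ) : x ^ (Nat.card F ^ i) = (-1) ^ i * x := by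
    rw [Nat.card_eq_fintype_card]
    induction i with
    | zero => simp
    | succ i ih =>
      rw [pow_succ, pow_mul, ih, mul_pow, hx, ← pow_mul, mul_comm i, pow_mul, neg_pow_card_base F,
        one_pow]
      ring
  apply (algebraMap F L).injective
  rw [algebraMap_trace_eq_sum_pow, hk, map_zero]
  simp only [h, ← Finset.sum_mul]
  rw [neg_one_geom_sum, if_pos (even_two_mul k), zero_mul]

theorem exists_primitive_trace_char (F L : Type*) [Field F] [Fintype F] [Field L] [Fintype L]
    [Algebra F L] : ∃ ψ : AddChar F ℂ, ψ ≠ 1 ∧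
      (ψ.compAddMonoidHom (Algebra.trace F L).toAddMonoidHom).IsPrimitive := by
  have hψ : AddChar.FiniteField.primitiveChar_to_Complex F ≠ 1 := by
    have := AddChar.FiniteField.primitiveChar_to_Complex_isPrimitive F one_ne_zero
    rwa [AddChar.mulShift_one] at this
  refine ⟨_, hψ, AddChar.IsPrimitive.of_ne_one ?_⟩
  obtain ⟨t, ht⟩ := AddChar.ne_one_iff.1 hψ
  obtain ⟨x, rfl⟩ := Algebra.trace_surjective F L t
  exact AddChar.ne_one_iff.2 ⟨x, ht⟩

open Classical in
/-- The square of `traceFormSum` is `|L|` times the size of the radical. -/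
theorem traceFormSum_sq {k : ℕ} (hk : Module.finrank F L = 2 * k) (a : L) :
    traceFormSum F a ^ 2 = (q : ℤ) ^ (2 * k) *
      (Finset.univ.filter fun z : L => a * z + a ^ q * z ^ (q ^ 2) = 0).card := by
  obtain ⟨ψ, hψ, hprim⟩ := exists_primitive_trace_char F L
  set T := Algebra.trace F L
  -- Polarisation: Frobenius invariance of the trace moves the cross term a z^q w onto w^q, so the
  -- difference is additive in w^q and its coefficient defines the radical.
  have key (z w : L) : T (a * (z + w) ^ (q + 1)) - T (a * w ^ (q + 1)) =
      T (a * z ^ (q + 1)) + T (w ^ q * (a * z + a ^ q * z ^ (q ^ 2))) := by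
    have h1 : T (a * z ^ q * w) = T (w ^ q * (a ^ q * z ^ (q ^ 2))) := by
      rw [← algebraTrace_pow_card]
      congr 1
      ring
    have h2 : a * (z + w) ^ (q + 1) =
        a * z ^ (q + 1) + a * z ^ q * w + w ^ q * (a * z) + a * w ^ (q + 1) := by
      rw [pow_succ, add_pow_card_base F]
      ring
    rw [h2, map_add, map_add, map_add, h1, mul_add, map_add]
    ring
  -- Since -1 is a (q+1)-th power, replacing ψ by its inverse does not change the sum; the square
  -- can thus be expanded as a sum times its conjugate.
  have hneg : (traceFormSum F a : ℂ) = ∑ z : L, ψ (-T (a * z ^ (q + 1))) := by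
    obtain ⟨l, hl, hl'⟩ := exists_pow_card_add_one_eq hk (-1 : F) (by simp)
    rw [traceFormSum_eq_sum hk a hψ, ← (mulLeft_bijective₀ l hl).sum_comp]
    refine Finset.sum_congr rfl fun z _ => ?_
    rw [mul_pow, hl', ← map_neg]
    congr 2
    simp
  have hinner (b : L) : ∑ w : L, ψ (T (w ^ q * b)) =
      if b = 0 then ((q ^ (2 * k) : ℕ) : ℂ) else 0 := by
    have h := AddChar.sum_mulShift b hprim
    rw [← (frobeniusAlgEquivOfAlgebraic F L).bijective.sum_comp,
      Module.card_eq_pow_finrank (K := F) (V := L), hk] at h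
    simpa using h
  have hmain : ((traceFormSum F a : ℤ) : ℂ) ^ 2 = (q : ℂ) ^ (2 * k) *
      (Finset.univ.filter fun z : L => a * z + a ^ q * z ^ (q ^ 2) = 0).card := by
    calc ((traceFormSum F a : ℤ) : ℂ) ^ 2
        = (∑ z : L, ψ (T (a * z ^ (q + 1)))) * ∑ w : L, ψ (-T (a * w ^ (q + 1))) := by
          rw [← hneg, ← traceFormSum_eq_sum hk a hψ, sq]
      _ = ∑ w : L, ∑ z : L, ψ (T (a * (z + w) ^ (q + 1)) - T (a * w ^ (q + 1))) := by
          rw [mul_comm, Finset.sum_mul]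
          refine Finset.sum_congr rfl fun w _ => ?_
          rw [Finset.mul_sum, ← (Equiv.addRight w).bijective.sum_comp]
          refine Finset.sum_congr rfl fun z _ => ?_
          rw [sub_eq_add_neg, AddChar.map_add_eq_mul, mul_comm]
          rfl
      _ = ∑ z : L, ψ (T (a * z ^ (q + 1))) *
            ∑ w : L, ψ (T (w ^ q * (a * z + a ^ q * z ^ (q ^ 2)))) := by
          rw [Finset.sum_comm]
          refine Finset.sum_congr rfl fun z _ => ?_
          rw [Finset.mul_sum]
          refine Finset.sum_congr rfl fun w _ => ?_
          rw [key, AddChar.map_add_eq_mul]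
      _ = ∑ z : L, if a * z + a ^ q * z ^ (q ^ 2) = 0 then (q : ℂ) ^ (2 * k) else 0 := by
          refine Finset.sum_congr rfl fun z _ => ?_
          rw [hinner]
          split_ifs with hz
          -- On the radical the form vanishes: the q-th power of a z^(q+1) is its negative.
          · have : T (a * z ^ (q + 1)) = 0 := by
              apply trace_eq_zero_of_pow_card_eq_neg hk
              have : a ^ q * z ^ (q ^ 2) = -(a * z) := by linear_combination hz
              calc (a * z ^ (q + 1)) ^ q = (a ^ q * z ^ (q ^ 2)) * z ^ q := by ring
                _ = _ := by rw [this]; ring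
            rw [this, AddChar.map_zero_eq_one]
            simp
          · simp
      _ = _ := by
          rw [← Finset.sum_filter, Finset.sum_const, nsmul_eq_mul, mul_comm]
  exact_mod_cast hmain

open Classical in
-- Dividing by z₀ turns the nonzero solutions into the kernel of t ↦ t^(q²-1), which has q²-1
-- elements because q²-1 divides |L*| in even degree.
theorem card_radical {k : ℕ} (hk : Module.finrank F L = 2 * k) {a z₀ : L} (ha : a ≠ 0) (hz₀ : z₀ ≠ 0)
    (h : a * z₀ + a ^ q * z₀ ^ (q ^ 2) = 0) :
    (Finset.univ.filter fun z : L => a * z + a ^ q * z ^ (q ^ 2) = 0).card = q ^ 2 := by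
  obtain ⟨s, -, -, hs, -⟩ := card_units_factor (F := F) (L := L) hk
  have hq : q ^ 2 = q ^ 2 - 1 + 1 := (Nat.sub_add_cancel (Nat.one_le_pow _ _ Fintype.card_pos)).symm
  have h0 : a ^ q * z₀ ^ (q ^ 2) = - (a * z₀) := by linear_combination h
  rw [Finset.card_filter, ← (mulLeft_bijective₀ z₀ hz₀).sum_comp, sum_eq_zero_add_sum_units]
  have h1 (t : Lˣ) : a * (z₀ * t) + a ^ q * (z₀ * t) ^ (q ^ 2) = 0 ↔ powMonoidHom (q ^ 2 - 1) t = 1 := by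
    have : a * (z₀ * t) + a ^ q * (z₀ * t) ^ (q ^ 2) =
        - (a * z₀ * t) * ((t : L) ^ (q ^ 2 - 1) - 1) := by
      rw [mul_pow, ← mul_assoc (a ^ q), h0, hq, pow_succ]
      simp
      ring
    rw [this, mul_eq_zero, sub_eq_zero]
    simp [ha, hz₀, Units.ext_iff]
  simp only [h1]
  rw [← Finset.card_filter, MonoidHom.card_fiber_eq_ite, if_pos (one_mem _),
    IsCyclic.card_powMonoidHom_ker, ← hs, Nat.gcd_mul_right_left]
  have : a * (z₀ * 0) + a ^ q * (z₀ * 0) ^ q ^ 2 = 0 := by simp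
  rw [if_pos this]
  omega


end FiniteField

/-- As -q ≡ 1 mod q+1, the opposite sign would force q+1 to divide 2. -/
theorem Int.eq_of_sq_eq_sq_of_dvd_sub_one {q j : ℕ} (hq : 2 ≤ q) {S : ℤ}
    (h : S ^ 2 = (q : ℤ) ^ (2 * j)) (hd : ((q : ℤ) + 1) ∣ S - 1) : S = (-(q : ℤ)) ^ j := by
  have h1 : S ^ 2 = ((-(q : ℤ)) ^ j) ^ 2 := by
    rw [h, ← pow_mul, mul_comm j, pow_mul, pow_mul, neg_sq]
  rcases sq_eq_sq_iff_eq_or_eq_neg.1 h1 with h2 | h2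
  · exact h2
  · exfalso
    have h3 : ((q : ℤ) + 1) ∣ (-(q : ℤ)) ^ j - 1 := by
      have h4 : (-(q : ℤ) - 1) ∣ (-(q : ℤ)) ^ j - 1 := by
        simpa using sub_dvd_pow_sub_pow (-(q : ℤ)) 1 j
      rwa [show (q : ℤ) + 1 = -(-(q : ℤ) - 1) by ring, neg_dvd]
    have h5 : ((q : ℤ) + 1) ∣ 2 := by
      obtain ⟨u, hu⟩ := hd
      obtain ⟨v, hv⟩ := h3
      rw [h2] at hu
      exact ⟨-(u + v), by linear_combination -hu - hv⟩
    have := Int.le_of_dvd (by norm_num) h5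
    omega

namespace FiniteField

variable {F L : Type*} [Field F] [Fintype F] [Field L] [Fintype L] [Algebra F L]

local notation "q" => Fintype.card F

theorem traceFormSum_eq_or {k s : ℕ} (hk : Module.finrank F L = 2 * k)
    (hs : (q ^ 2 - 1) * s = Nat.card Lˣ) (a : Lˣ) :
    traceFormSum F (a : L) = (-(q : ℤ)) ^ k ∨
      (traceFormSum F (a : L) = (-(q : ℤ)) ^ (k + 1) ∧ a ^ ((q - 1) * s) = (-1) ^ s) := by
  classical
  have hq : 2 ≤ q := Fintype.one_lt_card
  have hsq := traceFormSum_sq hk (a : L)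
  have hd := traceFormSum_modEq hk (a : L)
  by_cases h : ∃ z : L, z ≠ 0 ∧ a * z + (a : L) ^ q * z ^ (q ^ 2) = 0
  · obtain ⟨z, hz, hz'⟩ := h
    right
    constructor
    · rw [card_radical hk a.ne_zero hz hz'] at hsq
      refine Int.eq_of_sq_eq_sq_of_dvd_sub_one hq ?_ hd
      rw [hsq]
      push_cast
      ring
    -- Raising this identity to the power s kills z, since (q²-1)s = |L*|, and leaves a condition on
    -- a alone.
    · have h1 : (a : L) ^ (q - 1) * z ^ (q ^ 2 - 1) = -1 := by
        have e1 : (a : L) ^ q = a ^ (q - 1) * a := by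
          rw [← pow_succ, Nat.sub_add_cancel (by omega)]
        have e2 : z ^ (q ^ 2) = z ^ (q ^ 2 - 1) * z := by
          rw [← pow_succ, Nat.sub_add_cancel (Nat.one_le_pow _ _ (by omega))]
        rw [e1, e2] at hz'
        have : (a : L) * z * ((a : L) ^ (q - 1) * z ^ (q ^ 2 - 1) + 1) = 0 := by
          linear_combination hz'
        rw [mul_eq_zero, or_iff_right (mul_ne_zero a.ne_zero hz)] at this
        linear_combination this
      have h2 : z ^ Nat.card Lˣ = 1 := by
        have h := congrArg Units.val (pow_card_eq_one' (x := Units.mk0 z hz))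
        rwa [Units.val_pow_eq_pow_val, Units.val_mk0, Units.val_one] at h
      have h3 := congrArg (· ^ s) h1
      simp only [mul_pow, ← pow_mul] at h3
      rw [hs, h2, mul_one] at h3
      apply Units.ext
      simpa using h3
  · left
    have : (Finset.univ.filter fun z : L => a * z + (a : L) ^ q * z ^ (q ^ 2) = 0) = {0} := by
      ext z
      simp only [Finset.mem_filter, Finset.mem_univ, true_and, Finset.mem_singleton]
      refine ⟨fun hz => by_contra fun h0 => h ⟨z, h0, hz⟩, ?_⟩
      rintro rfl
      simp
    rw [this] at hsq
    exact Int.eq_of_sq_eq_sq_of_dvd_sub_one hq (by simpa using hsq) hd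

theorem traceFormSum_zero {k : ℕ} (hk : Module.finrank F L = 2 * k) :
    traceFormSum F (0 : L) = (q : ℤ) ^ (2 * k) := by
  have h : Fintype.card L = q ^ (2 * k) := by
    rw [Module.card_eq_pow_finrank (K := F) (V := L), hk]
  simp [traceFormSum, traceFormCount, h]

open Classical in
-- Summing over all a, orthogonality keeps only z = 0 and yields |L|, which is already the term a =
-- 0.
theorem sum_traceFormSum_units {k : ℕ} (hk : Module.finrank F L = 2 * k) :
    ∑ a : Lˣ, traceFormSum F (a : L) = 0 := by
  obtain ⟨ψ, hψ, hprim⟩ := exists_primitive_trace_char F L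
  have h : ((∑ a : L, traceFormSum F a : ℤ) : ℂ) = (q : ℂ) ^ (2 * k) := by
    push_cast
    simp only [traceFormSum_eq_sum hk _ hψ]
    rw [Finset.sum_comm]
    have h1 (z : L) := AddChar.sum_mulShift (z ^ (q + 1)) hprim
    simp only [AddChar.compAddMonoidHom_apply, LinearMap.toAddMonoidHom_coe] at h1
    simp only [h1]
    simp [Module.card_eq_pow_finrank (K := F) (V := L), hk]
  have h' : ∑ a : L, traceFormSum F a = (q : ℤ) ^ (2 * k) := by exact_mod_cast h
  rw [sum_eq_zero_add_sum_units, traceFormSum_zero hk] at h'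
  linarith

open Classical in
/-- The values of the Gauss sums of order `q + 1` over a field of degree `2 * k` over `F`: the
exceptional value `(-q) ^ (k + 1)` is attained exactly on one coset of the `(q + 1)`-th powers. -/
theorem exists_traceFormSum_eq_ite {k : ℕ} (hk : Module.finrank F L = 2 * k) :
    ∃ c : Lˣ, (∀ a : Lˣ, traceFormSum F (a : L) =
      if a ^ (Nat.card Lˣ / (q + 1)) = c then (-(q : ℤ)) ^ (k + 1) else (-(q : ℤ)) ^ k) ∧
      (q + 1) * (Finset.univ.filter fun a : Lˣ => a ^ (Nat.card Lˣ / (q + 1)) = c).card =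
        Nat.card Lˣ := by
  obtain ⟨s, he, -, hs, -⟩ := card_units_factor (F := F) (L := L) hk
  have hq : 2 ≤ q := Fintype.one_lt_card
  have hdiv : Nat.card Lˣ / (q + 1) = (q - 1) * s := by
    rw [← he, Nat.mul_div_cancel_left _ (Nat.succ_pos _)]
  rw [hdiv]
  set e := (q - 1) * s with he_def
  set sp := Finset.univ.filter fun a : Lˣ => traceFormSum F (a : L) = (-(q : ℤ)) ^ (k + 1)
  have hval (a : Lˣ) : traceFormSum F (a : L) =
      if a ∈ sp then (-(q : ℤ)) ^ (k + 1) else (-(q : ℤ)) ^ k := by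
    split_ifs with h
    · exact (Finset.mem_filter.1 h).2
    · refine (traceFormSum_eq_or hk hs a).resolve_right fun h' => h ?_
      exact Finset.mem_filter.2 ⟨Finset.mem_univ _, h'.1⟩
  have hne : (-(q : ℤ)) ^ k ≠ (-(q : ℤ)) ^ (k + 1) := by
    intro h
    rw [pow_succ] at h
    have h0 : (-(q : ℤ)) ^ k ≠ 0 := pow_ne_zero _ (by omega)
    have : (-(q : ℤ)) = 1 := mul_left_cancel₀ h0 (by rw [← h, mul_one])
    omega
  have hsub : sp ⊆ Finset.univ.filter fun a : Lˣ => a ^ e = (-1) ^ s := by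
    intro a ha
    refine Finset.mem_filter.2 ⟨Finset.mem_univ _, ?_⟩
    rcases traceFormSum_eq_or hk hs a with h | h
    · exact absurd (h.symm.trans (Finset.mem_filter.1 ha).2) hne
    · exact h.2
  -- With only two possible values, in ratio -q, the vanishing total fixes how often each occurs.
  have hcard : (q + 1) * sp.card = Nat.card Lˣ := by
    have hsum := sum_traceFormSum_units (F := F) (L := L) hk
    simp only [hval] at hsum
    rw [Finset.sum_ite, Finset.sum_const, Finset.sum_const, Finset.filter_mem_eq_inter,
      Finset.univ_inter, Finset.filter_notMem_eq_sdiff, Finset.card_sdiff_of_subset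
      (Finset.subset_univ sp), nsmul_eq_mul, nsmul_eq_mul, Nat.cast_sub (Finset.card_le_card (Finset.subset_univ sp)),
      pow_succ] at hsum
    have h0 : (-(q : ℤ)) ^ k ≠ 0 := pow_ne_zero _ (by omega)
    have h1 : (-(q : ℤ)) ^ k * ((Finset.univ : Finset Lˣ).card - (q + 1) * sp.card) = 0 := by
      linear_combination hsum
    rw [mul_eq_zero, or_iff_right h0] at h1
    rw [Nat.card_eq_fintype_card, ← Finset.card_univ (α := Lˣ)]
    zify
    linarith
  -- A fibre of the e-th power map has at most e elements, and `sp` already has e, so the inclusion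
  -- `hsub` is an equality.
  have hle : (Finset.univ.filter fun a : Lˣ => a ^ e = (-1) ^ s).card ≤ sp.card := by
    have h1 := MonoidHom.card_fiber_eq_ite (powMonoidHom e : Lˣ →* Lˣ) ((-1) ^ s)
    rw [IsCyclic.card_powMonoidHom_ker, ← he, Nat.gcd_mul_left_left] at h1
    have h2 : sp.card = e := Nat.eq_of_mul_eq_mul_left (Nat.succ_pos q) (hcard.trans he.symm)
    rw [h2]
    refine (le_of_eq h1).trans ?_
    split_ifs <;> simp
  have heq := Finset.eq_of_subset_of_card_le hsub hle
  refine ⟨(-1) ^ s, fun a => ?_, ?_⟩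
  · rw [hval, heq]
    simp
  · rw [← heq, hcard]

end FiniteField

/-! ### Averaging over gcd-th powers. -/

/-- By Bézout, z^gcd(a,b) is an a-th power times a b-th power. The first is absorbed by f; the
second becomes a translation of y, absorbed by g. -/
theorem sum_mul_pow_gcd_mul {G R : Type*} [CommGroup G] [Fintype G] [CommRing R] {a b : ℕ}
    {f g : G → R} (hf : ∀ y z, f (y * z ^ a) = f y) (hg : ∀ y z, g (y * z ^ b) = g y) (z : G) :
    ∑ y, f (y * z ^ a.gcd b) * g y = ∑ y, f y * g y := by
  have hz : z ^ a.gcd b = (z ^ a.gcdB b) ^ b * (z ^ a.gcdA b) ^ a := by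
    rw [← zpow_natCast, Nat.gcd_eq_gcd_ab, zpow_add, mul_comm (a : ℤ), mul_comm (b : ℤ), zpow_mul,
      zpow_mul, zpow_natCast, zpow_natCast, mul_comm]
  rw [hz, ← (Equiv.mulRight ((z ^ a.gcdB b) ^ b)).bijective.sum_comp fun y => f y * g y]
  refine Finset.sum_congr rfl fun y _ => ?_
  rw [← mul_assoc, hf, Equiv.coe_mulRight, hg]

/-- The sum of a product of two functions, one invariant under `a`-th powers and the other under
`b`-th powers, only depends on their averages over the `gcd(a, b)`-th powers. -/
theorem card_sq_mul_sum_mul_eq {G R : Type*} [CommGroup G] [Fintype G] [CommRing R] {a b : ℕ}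
    {f g : G → R} (hf : ∀ y z, f (y * z ^ a) = f y) (hg : ∀ y z, g (y * z ^ b) = g y) :
    (Fintype.card G : R) ^ 2 * ∑ y, f y * g y =
      ∑ y, (∑ z, f (y * z ^ a.gcd b)) * ∑ z, g (y * z ^ a.gcd b) := by
  have h (z w : G) : ∑ y, f (y * z ^ a.gcd b) * g (y * w ^ a.gcd b) = ∑ y, f y * g y := by
    rw [← sum_mul_pow_gcd_mul hf hg (z * w⁻¹),
      ← (Equiv.mulRight (w ^ a.gcd b)⁻¹).bijective.sum_comp]
    refine Finset.sum_congr rfl fun y _ => ?_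
    rw [Equiv.coe_mulRight, inv_mul_cancel_right, mul_pow, inv_pow, mul_assoc,
      mul_comm (w ^ _)⁻¹]
  simp only [Finset.sum_mul_sum]
  rw [Finset.sum_comm]
  have h2 (z : G) : ∑ y, ∑ w, f (y * z ^ a.gcd b) * g (y * w ^ a.gcd b) =
      Fintype.card G * ∑ y, f y * g y := by
    rw [Finset.sum_comm]
    simp only [h, Finset.sum_const, Finset.card_univ, nsmul_eq_mul]
  simp only [h2, Finset.sum_const, Finset.card_univ, nsmul_eq_mul]
  ring

/-! ### Norms, traces and the joint count for two subfields. -/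

namespace FiniteField

/-- Inside K the norm is the power with exponent |K*|/|L*|, so the exponents multiply. Conditions
living in different subfields become comparable in K*. -/
theorem units_norm_pow_eq_iff {L K : Type*} [Field L] [Field K] [Finite K] [Algebra L K] {d : ℕ}
    (hd : d ∣ Nat.card Lˣ) (y : Kˣ) (c : Lˣ) :
    Units.map (Algebra.norm L) y ^ (Nat.card Lˣ / d) = c ↔
      y ^ (Nat.card Kˣ / d) = Units.map (algebraMap L K).toMonoidHom c := by
  have : Finite L := Finite.of_injective _ (algebraMap L K).injective
  have hdvd : Nat.card Lˣ ∣ Nat.card Kˣ := by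
    exact Subgroup.card_dvd_of_injective (Units.map (algebraMap L K).toMonoidHom)
      (Units.map_injective (algebraMap L K).injective)
  have hpos : 0 < Nat.card Lˣ := Nat.card_pos
  obtain ⟨u, hu⟩ := hd
  obtain ⟨v, hv⟩ := hdvd
  have hd0 : 0 < d := Nat.pos_of_ne_zero (by rintro rfl; simp at hu; omega)
  have h1 : Nat.card Kˣ / d = v * (Nat.card Lˣ / d) := by
    rw [hv, hu, Nat.mul_div_cancel_left _ hd0, mul_assoc, Nat.mul_div_cancel_left _ hd0, mul_comm]
  have h2 : (Nat.card K - 1) / (Nat.card L - 1) = v := by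
    rw [← Nat.card_units, ← Nat.card_units, hv, Nat.mul_div_cancel_left _ hpos]
  have h3 : Units.map (algebraMap L K).toMonoidHom (Units.map (Algebra.norm L) y) = y ^ v := by
    ext
    simp [algebraMap_norm_eq_pow, h2]
  rw [h1, pow_mul, ← h3]
  exact (Units.map_injective (algebraMap L K).injective).eq_iff.symm.trans (by rw [map_pow])

variable {F L K : Type*} [Field F] [Fintype F] [Field L] [Fintype L] [Field K] [Fintype K]
  [Algebra F L] [Algebra L K]

local notation "q" => Fintype.card F

open Classical in
/-- The number of nonzero elements of trace zero. -/
theorem card_mul_card_units_trace_eq_zero (F L : Type*) [Field F] [Fintype F] [Field L] [Fintype L]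
    [Algebra F L] :
    Fintype.card F * ((Finset.univ.filter fun v : Lˣ => Algebra.trace F L v = 0).card + 1) =
      Fintype.card L := by
  have h := (Algebra.trace F L).toAddMonoidHom.ker.card_mul_index
  rw [AddSubgroup.index_ker, AddMonoidHom.range_eq_top.2 (Algebra.trace_surjective F L),
    AddSubgroup.card_top, Nat.card_eq_fintype_card (α := F),
    Nat.card_eq_fintype_card (α := L)] at h
  have h2 : Nat.card (Algebra.trace F L).toAddMonoidHom.ker =
      (Finset.univ.filter fun v : Lˣ => Algebra.trace F L v = 0).card + 1 := by
    have h0 := sum_eq_zero_add_sum_units fun v : L => if Algebra.trace F L v = 0 then 1 else 0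
    rw [map_zero, if_pos rfl, ← Finset.card_filter, ← Finset.card_filter, add_comm] at h0
    rw [← h0]
    exact Nat.subtype_card _ (by simp)
  rw [← h, ← h2, mul_comm]

open Classical in
theorem traceFormCount_zero_eq_units (a : L) :
    traceFormCount F a 0 = 1 + ∑ v : Lˣ,
      if Algebra.trace F L (a * v ^ (q + 1)) = 0 then 1 else 0 := by
  rw [traceFormCount, Finset.card_filter, sum_eq_zero_add_sum_units]
  simp

open Classical in
/-- The average of `[Tr(x N(y z ^ (q + 1))) = 0]` over `z`. -/
theorem card_units_mul_sum_trace_norm {k : ℕ} (hk : Module.finrank F L = 2 * k) :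
    ∃ c : Lˣ, (q + 1) * (Finset.univ.filter fun a : Lˣ => a ^ (Nat.card Lˣ / (q + 1)) = c).card =
        Nat.card Lˣ ∧ ∀ (x : Lˣ) (y : Kˣ),
      (Nat.card Lˣ : ℚ) * ∑ z : Kˣ, (if Algebra.trace F L
          (x * Algebra.norm L ((y * z ^ (q + 1) : Kˣ) : K)) = 0 then 1 else 0) =
        Nat.card Kˣ * ((q : ℚ) ^ (2 * k) / q - 1 + (q - 1) * (-q : ℚ) ^ k / q *
          (1 - (q + 1) * if (x * Units.map (Algebra.norm L) y) ^ (Nat.card Lˣ / (q + 1)) = c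
            then 1 else 0)) := by
  obtain ⟨c, hc, hcard⟩ := exists_traceFormSum_eq_ite (F := F) (L := L) hk
  refine ⟨c, hcard, fun x y => ?_⟩
  have hq : (q : ℚ) ≠ 0 := by simp
  have h1 := MonoidHom.sum_comp_eq_of_surjective (R := ℚ) (Units.map (Algebra.norm L) : Kˣ →* Lˣ)
    (unitsMap_norm_surjective L K) fun v : Lˣ =>
      if Algebra.trace F L ((x * Units.map (Algebra.norm L) y : Lˣ) * v ^ (q + 1)) = 0
        then 1 else 0
  have h2 := traceFormCount_zero_eq_units (F := F) ((x * Units.map (Algebra.norm L) y : Lˣ) : L)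
  have h3 := card_mul_traceFormCount_zero hk ((x * Units.map (Algebra.norm L) y : Lˣ) : L)
  rw [hc, h2] at h3
  have h4 := congrArg (Int.cast (R := ℚ)) h3
  push_cast at h4
  have h5 (z : Kˣ) : (x : L) * Algebra.norm L ((y * z ^ (q + 1) : Kˣ) : K) =
      (x * Units.map (Algebra.norm L) y : Lˣ) * (Units.map (Algebra.norm L) z : Lˣ) ^ (q + 1) := by
    simp [mul_assoc]
  simp only [h5]
  rw [h1]
  congr 1
  push_cast
  rw [← mul_right_inj' hq]
  split_ifs at h4 ⊢ <;> field_simp <;> rw [pow_succ] at * <;> linear_combination h4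

end FiniteField

namespace FiniteField

variable {F L L₁ L₂ K : Type*} [Field F] [Fintype F] [Field L] [Fintype L] [Field L₁] [Fintype L₁]
  [Field L₂] [Fintype L₂] [Field K] [Fintype K]
  [Algebra F L] [Algebra L K] [Algebra F L₁] [Algebra L₁ K] [Algebra F L₂] [Algebra L₂ K]

local notation "q" => Fintype.card F

/-- The exponent is that of the norm from L to F, so the extra factor is a nonzero scalar of F and
leaves the trace. -/
theorem trace_mul_norm_mul_pow_eq_zero_iff (x : L) (y z : Kˣ) :
    Algebra.trace F L (x * Algebra.norm L
      ((y * z ^ ((Nat.card L - 1) / (Nat.card F - 1)) : Kˣ) : K)) = 0 ↔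
      Algebra.trace F L (x * Algebra.norm L (y : K)) = 0 := by
  have h : Algebra.norm L (z : K) ≠ 0 := by simp
  have h' : Algebra.norm F (Algebra.norm L (z : K)) ≠ 0 := by simp
  have : x * Algebra.norm L ((y * z ^ ((Nat.card L - 1) / (Nat.card F - 1)) : Kˣ) : K) =
      Algebra.norm F (Algebra.norm L (z : K)) • (x * Algebra.norm L (y : K)) := by
    rw [Algebra.smul_def, algebraMap_norm_eq_pow]
    simp
    ring
  rw [this, map_smul, smul_eq_zero, or_iff_right h']

theorem gcd_card_sub_one_div {k₁ k₂ : ℕ} (h₁ : Module.finrank F L₁ = 2 * k₁)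
    (h₂ : Module.finrank F L₂ = 2 * k₂) (hk : k₁.Coprime k₂) :
    ((Nat.card L₁ - 1) / (Nat.card F - 1)).gcd ((Nat.card L₂ - 1) / (Nat.card F - 1)) = q + 1 := by
  have hq : 2 ≤ q := Fintype.one_lt_card
  have hdiv (n : ℕ) : q - 1 ∣ q ^ n - 1 := by simpa using Nat.sub_dvd_pow_sub_pow q 1 n
  rw [Nat.card_eq_fintype_card, Nat.card_eq_fintype_card, Nat.card_eq_fintype_card,
    Module.card_eq_pow_finrank (K := F) (V := L₁), Module.card_eq_pow_finrank (K := F) (V := L₂),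
    h₁, h₂, Nat.gcd_div (hdiv _) (hdiv _), Nat.pow_sub_one_gcd_pow_sub_one, Nat.gcd_mul_left, hk,
    mul_one, show q ^ 2 - 1 = (q + 1) * (q - 1) by simpa using Nat.sq_sub_sq q 1,
    Nat.mul_div_cancel _ (by omega)]

open Classical in
/-- The preimage under `y ↦ x N(y)` of the exceptional coset has the expected density. -/
theorem card_filter_mul_norm_pow_eq {c : Lˣ} {d e : ℕ}
    (hc : d * (Finset.univ.filter fun a : Lˣ => a ^ e = c).card = Nat.card Lˣ) (x : Lˣ) :
    (d : ℚ) * ∑ y : Kˣ, (if (x * Units.map (Algebra.norm L) y) ^ e = c then 1 else 0) =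
      Nat.card Kˣ := by
  have h1 := MonoidHom.sum_comp_eq_of_surjective (R := ℚ) (Units.map (Algebra.norm L) : Kˣ →* Lˣ)
    (unitsMap_norm_surjective L K) fun v : Lˣ => if (x * v) ^ e = c then 1 else 0
  have h2 : ∑ v : Lˣ, (if (x * v) ^ e = c then (1 : ℚ) else 0) =
      ∑ v : Lˣ, if v ^ e = c then (1 : ℚ) else 0 :=
    (Equiv.mulLeft x).bijective.sum_comp fun v : Lˣ => if v ^ e = c then (1 : ℚ) else 0
  rw [h2, Finset.sum_boole (p := fun v : Lˣ => v ^ e = c)] at h1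
  have hL : (Nat.card Lˣ : ℚ) ≠ 0 := Nat.cast_ne_zero.2 Nat.card_pos.ne'
  rw [← mul_right_inj' hL, mul_left_comm, h1, mul_left_comm, mul_comm]
  rw [← hc]
  push_cast
  ring_nf

open Classical in
-- The functions 1 - d·1_A and 1 - d·1_B have mean zero, so the mixed terms vanish. The mean of
-- their product is d-1 if E holds, when A implies B, and -1 otherwise, when A and B are disjoint.
theorem sum_one_sub_mul_one_sub {G : Type*} [Fintype G] {d : ℚ} {A B : G → Prop}
    {α₁ β₁ α₂ β₂ : ℚ} (hA : d * ∑ y, (if A y then 1 else 0) = Fintype.card G)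
    (hB : d * ∑ y, (if B y then 1 else 0) = Fintype.card G) (E : Prop)
    (hE : ∀ y, A y ∧ B y ↔ A y ∧ E) :
    ∑ y, (α₁ + β₁ * (1 - d * if A y then 1 else 0)) * (α₂ + β₂ * (1 - d * if B y then 1 else 0)) =
      Fintype.card G * (α₁ * α₂ + β₁ * β₂ * if E then d - 1 else -1) := by
  have h (y : G) : (α₁ + β₁ * (1 - d * if A y then 1 else 0)) *
      (α₂ + β₂ * (1 - d * if B y then 1 else 0)) = (α₁ + β₁) * (α₂ + β₂) -
        (α₂ + β₂) * β₁ * (d * if A y then 1 else 0) - (α₁ + β₁) * β₂ * (d * if B y then 1 else 0) +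
        β₁ * β₂ * (if E then d else 0) * (d * if A y then 1 else 0) := by
    have := hE y
    by_cases h1 : A y <;> by_cases h2 : B y <;> by_cases h3 : E <;> simp_all <;> ring
  simp only [h, Finset.sum_add_distrib, Finset.sum_sub_distrib, ← Finset.mul_sum, hA, hB,
    Finset.sum_const, Finset.card_univ, nsmul_eq_mul]
  split_ifs <;> ring

open Classical in
/-- The joint distribution of `Tr(x N(y)) = 0` and `Tr(N(y)) = 0` for the norms and traces of two
subfields of coprime half-degree takes only two values as `x` varies. -/
theorem exists_card_trace_norm_eq_zero {k₁ k₂ : ℕ} (h₁ : Module.finrank F L₁ = 2 * k₁)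
    (h₂ : Module.finrank F L₂ = 2 * k₂) (hk : k₁.Coprime k₂) (K : Type*) [Field K] [Fintype K]
    [Algebra L₁ K] [Algebra L₂ K] :
    ∃ E : Finset L₁ˣ, (q + 1) * E.card = Nat.card L₁ˣ ∧ ∀ x : L₁ˣ,
      (Nat.card L₁ˣ : ℚ) * Nat.card L₂ˣ * (Finset.univ.filter fun y : Kˣ =>
        Algebra.trace F L₂ (Algebra.norm L₂ (y : K)) = 0 ∧
          Algebra.trace F L₁ (x * Algebra.norm L₁ (y : K)) = 0).card =
      Nat.card Kˣ * (((q : ℚ) ^ (2 * k₁) / q - 1) * ((q : ℚ) ^ (2 * k₂) / q - 1) +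
        ((q - 1) * (-q : ℚ) ^ k₁ / q) * ((q - 1) * (-q : ℚ) ^ k₂ / q) *
          if x ∈ E then (q : ℚ) else -1) := by
  obtain ⟨c₁, hc₁, hs₁⟩ := card_units_mul_sum_trace_norm (F := F) (L := L₁) (K := K) h₁
  obtain ⟨c₂, hc₂, hs₂⟩ := card_units_mul_sum_trace_norm (F := F) (L := L₂) (K := K) h₂
  have hK : (Nat.card Kˣ : ℚ) ≠ 0 := Nat.cast_ne_zero.2 Nat.card_pos.ne'
  have hd₁ : q + 1 ∣ Nat.card L₁ˣ := ⟨_, hc₁.symm⟩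
  have hd₂ : q + 1 ∣ Nat.card L₂ˣ := ⟨_, hc₂.symm⟩
  have hB := card_filter_mul_norm_pow_eq (K := K) hc₂ 1
  -- A representative of the exceptional coset of L₂ in K*; E consists of the x for which it is
  -- exceptional for L₁ too.
  obtain ⟨y₀, hy₀⟩ : ∃ y₀ : Kˣ, (1 * Units.map (Algebra.norm L₂) y₀) ^ (Nat.card L₂ˣ / (q + 1)) =
      c₂ := by
    by_contra! h
    simp only [h, if_false, Finset.sum_const_zero, mul_zero] at hB
    exact hK hB.symm
  refine ⟨Finset.univ.filter fun x =>
    (x * Units.map (Algebra.norm L₁) y₀) ^ (Nat.card L₁ˣ / (q + 1)) = c₁, ?_, fun x => ?_⟩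
  · refine Eq.trans (congrArg _ ?_) hc₁
    refine Finset.card_bijective _ (Group.mulRight_bijective (Units.map (Algebra.norm L₁) y₀)) ?_
    simp
  have hA := card_filter_mul_norm_pow_eq (K := K) hc₁ x
  -- Both conditions prescribe y^(|K*|/(q+1)), so they are compatible exactly when the prescribed
  -- values agree, which is tested at y₀.
  have hE (y : Kˣ) : ((x * Units.map (Algebra.norm L₁) y) ^ (Nat.card L₁ˣ / (q + 1)) = c₁ ∧
      (1 * Units.map (Algebra.norm L₂) y) ^ (Nat.card L₂ˣ / (q + 1)) = c₂) ↔
      ((x * Units.map (Algebra.norm L₁) y) ^ (Nat.card L₁ˣ / (q + 1)) = c₁ ∧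
      (x * Units.map (Algebra.norm L₁) y₀) ^ (Nat.card L₁ˣ / (q + 1)) = c₁) := by
    rw [one_mul, units_norm_pow_eq_iff hd₂] at *
    have h3 (y : Kˣ) : (x * Units.map (Algebra.norm L₁) y) ^ (Nat.card L₁ˣ / (q + 1)) = c₁ ↔
        y ^ (Nat.card Kˣ / (q + 1)) = Units.map (algebraMap L₁ K).toMonoidHom
          ((x ^ (Nat.card L₁ˣ / (q + 1)))⁻¹ * c₁) := by
      rw [← units_norm_pow_eq_iff hd₁, mul_pow, eq_inv_mul_iff_mul_eq]
    rw [h3, h3, hy₀]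
    constructor
    · rintro ⟨h4, h5⟩
      exact ⟨h4, h5.symm.trans h4⟩
    · rintro ⟨h4, h5⟩
      exact ⟨h4, h4.trans h5.symm⟩
  set f₁ : Kˣ → ℚ := fun y => if Algebra.trace F L₁ (x * Algebra.norm L₁ (y : K)) = 0 then 1 else 0
  set f₂ : Kˣ → ℚ := fun y =>
    if Algebra.trace F L₂ ((1 : L₂ˣ) * Algebra.norm L₂ (y : K)) = 0 then 1 else 0
  have hmain := card_sq_mul_sum_mul_eq (f := f₁) (g := f₂)
    (a := (Nat.card L₁ - 1) / (Nat.card F - 1)) (b := (Nat.card L₂ - 1) / (Nat.card F - 1))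
    (fun y z => by simp only [f₁, trace_mul_norm_mul_pow_eq_zero_iff])
    (fun y z => by simp only [f₂, trace_mul_norm_mul_pow_eq_zero_iff])
  rw [gcd_card_sub_one_div h₁ h₂ hk] at hmain
  have hcount : ((Finset.univ.filter fun y : Kˣ =>
        Algebra.trace F L₂ (Algebra.norm L₂ (y : K)) = 0 ∧
          Algebra.trace F L₁ (x * Algebra.norm L₁ (y : K)) = 0).card : ℚ) = ∑ y, f₁ y * f₂ y := by
    rw [← Finset.sum_boole]
    refine Finset.sum_congr rfl fun y _ => ?_
    simp only [f₁, f₂, Units.val_one, one_mul]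
    split_ifs <;> simp_all
  have hsum := sum_one_sub_mul_one_sub (G := Kˣ) (d := (q : ℚ) + 1)
    (α₁ := (q : ℚ) ^ (2 * k₁) / q - 1) (α₂ := (q : ℚ) ^ (2 * k₂) / q - 1)
    (β₁ := (q - 1) * (-q : ℚ) ^ k₁ / q) (β₂ := (q - 1) * (-q : ℚ) ^ k₂ / q)
    (by rw [← Nat.card_eq_fintype_card (α := Kˣ)]; exact_mod_cast hA)
    (by rw [← Nat.card_eq_fintype_card (α := Kˣ)]; exact_mod_cast hB) _ hE
  rw [hcount]
  rw [← Nat.card_eq_fintype_card (α := Kˣ)] at hmain hsum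
  rw [← mul_right_inj' (pow_ne_zero 2 hK), mul_left_comm, hmain, Finset.mul_sum]
  rw [add_sub_cancel_right] at hsum
  refine Eq.trans ?_ (congrArg ((Nat.card Kˣ : ℚ) ^ 2 * ·) (hsum.trans ?_))
  swap
  · congr! 4
    simp
  rw [Finset.mul_sum]
  refine Finset.sum_congr rfl fun y _ => ?_
  rw [mul_mul_mul_comm]
  refine (congrArg₂ HMul.hMul (hs₁ x y) (hs₂ 1 y)).trans ?_
  ring_nf

end FiniteField

/-! ### Passing to orbit representatives. -/

open Classical in
/-- Counting the elements of `D` with an `F*`-invariant property through orbit representatives. -/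
theorem IsShortenedSet.card_filter_eq {F K : Type*} [Field F] [Fintype F] [Field K] [Fintype K]
    [Algebra F K] {D D₁ : Set K} (h : IsShortenedSet F D D₁) (h0 : (0 : K) ∉ D) {n : ℕ}
    {d : Fin n → K} (hd : Function.Injective d) (hrange : Set.range d = D₁) (p : K → Prop)
    (hp : ∀ (u : F) (y : K), u ≠ 0 → (p (algebraMap F K u * y) ↔ p y)) :
    (Finset.univ.filter fun y : Kˣ => (y : K) ∈ D ∧ p y).card =
      (Fintype.card F - 1) * (Finset.univ.filter fun i => p (d i)).card := by
  have hd₁ (i : Fin n) : d i ∈ D₁ := hrange ▸ Set.mem_range_self i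
  have hD (u : F) (hu : u ≠ 0) (i : Fin n) : algebraMap F K u * d i ∈ D := by
    rw [h.eq_smul]
    exact ⟨u, hu, d i, hd₁ i, rfl⟩
  have hd0 (i : Fin n) : d i ≠ 0 := by
    intro hi
    apply h0
    have := hD 1 one_ne_zero i
    rwa [hi, mul_zero] at this
  rw [← Nat.card_eq_fintype_card, ← Nat.card_units, Nat.card_eq_fintype_card, ← Finset.card_univ,
    ← Finset.card_product]
  symm
  refine Finset.card_bij (fun a _ => Units.map (algebraMap F K).toMonoidHom a.1 *
    Units.mk0 (d a.2) (hd0 a.2)) ?_ ?_ ?_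
  · rintro ⟨u, i⟩ ha
    simp only [Finset.mem_product, Finset.mem_univ, Finset.mem_filter, true_and] at ha ⊢
    exact ⟨hD u u.ne_zero i, (hp u (d i) u.ne_zero).2 ha⟩
  · rintro ⟨u, i⟩ - ⟨v, j⟩ - hab
    have hab' : algebraMap F K u * d i = algebraMap F K v * d j := congrArg Units.val hab
    have hij : i = j := by
      by_contra hij
      refine h.div_ne _ (hd₁ i) _ (hd₁ j) (hd.ne hij) (v / u) (div_ne_zero v.ne_zero u.ne_zero) ?_
      have hu : algebraMap F K u ≠ 0 := by simp
      rw [map_div₀, div_eq_div_iff (hd0 j) hu]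
      linear_combination hab'
    subst hij
    have := mul_right_cancel₀ (hd0 i) hab'
    rw [Units.ext ((algebraMap F K).injective this)]
  · intro y hy
    simp only [Finset.mem_filter, Finset.mem_univ, true_and] at hy
    have hyD := hy.1
    rw [h.eq_smul] at hyD
    obtain ⟨u, hu, v, hv, hyv⟩ := hyD
    rw [← hrange] at hv
    obtain ⟨i, rfl⟩ := hv
    refine ⟨⟨Units.mk0 u hu, i⟩, ?_, Units.ext hyv.symm⟩
    simp only [Finset.mem_product, Finset.mem_univ, Finset.mem_filter, true_and]
    rw [← hp u _ hu, ← hyv]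
    exact hy.2

/-! ### Weight enumerators of parametrized codes. -/

section Enumerator

open Classical in
theorem weightCount_range {F V : Type*} [Field F] [AddCommGroup V] [Module F V] [Fintype V] {n : ℕ}
    {Φ : V →ₗ[F] Fin n → F} (hΦ : Function.Injective Φ) (i : ℕ) :
    weightCount (LinearMap.range Φ) i =
      (Finset.univ.filter fun x => hammingNorm (Φ x) = i).card := by
  rw [weightCount, ← Finset.card_image_of_injective _ hΦ, ← Set.ncard_coe_finset]
  congr 1
  ext c
  simp only [Set.mem_ofPred_eq, LinearMap.mem_range, Finset.coe_image, Finset.coe_filter,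
    Finset.mem_univ, true_and, Set.mem_image]
  constructor
  · rintro ⟨⟨x, rfl⟩, hx⟩
    exact ⟨x, hx, rfl⟩
  · rintro ⟨x, hx, rfl⟩
    exact ⟨⟨x, rfl⟩, hx⟩

open Classical in
theorem weightEnumerator_range {F V : Type*} [Field F] [AddCommGroup V] [Module F V] [Fintype V]
    {n : ℕ} {Φ : V →ₗ[F] Fin n → F} (hΦ : Function.Injective Φ) :
    weightEnumerator (LinearMap.range Φ) = ∑ x, X ^ hammingNorm (Φ x) := by
  rw [weightEnumerator, ← Finset.sum_fiberwise_of_maps_to (t := Finset.range (n + 1))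
    (g := fun x => hammingNorm (Φ x))]
  · refine Finset.sum_congr rfl fun i _ => ?_
    rw [Finset.sum_congr rfl (g := fun _ => X ^ i) (by simp +contextual), Finset.sum_const,
      weightCount_range hΦ, nsmul_eq_mul, map_natCast]
  · intro x _
    rw [Finset.mem_range, Nat.lt_succ_iff]
    simpa using hammingNorm_le_card_fintype (x := Φ x)

open Classical in
/-- A code parametrized by a field, whose nonzero codewords have one weight on `E` and another one
off `E`. -/
theorem two_weight_of_hammingNorm {F L : Type*} [Field F] [Field L] [Algebra F L] [Fintype L]
    {n : ℕ} {Φ : L →ₗ[F] Fin n → F} {E : Finset Lˣ} {w₁ w₂ : ℕ} (hE : E.Nonempty)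
    (hE' : Eᶜ.Nonempty) (hw₁ : 0 < w₁) (hw₂ : 0 < w₂) (hne : w₁ ≠ w₂)
    (h₁ : ∀ x ∈ E, hammingNorm (Φ x) = w₁) (h₂ : ∀ x ∉ E, hammingNorm (Φ (x : Lˣ)) = w₂) :
    Function.Injective Φ ∧ IsTWeight 2 (LinearMap.range Φ) ∧
      weightEnumerator (LinearMap.range Φ) =
        1 + C (E.card : ℚ) * X ^ w₁ + C (Eᶜ.card : ℚ) * X ^ w₂ := by
  have hpos (x : Lˣ) : hammingNorm (Φ x) = w₁ ∨ hammingNorm (Φ x) = w₂ :=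
    (_root_.em (x ∈ E)).imp (h₁ x) (h₂ x)
  have hinj : Function.Injective Φ := by
    rw [injective_iff_map_eq_zero]
    intro x hx
    by_contra hx0
    have := hpos (Units.mk0 x hx0)
    rw [Units.val_mk0, hx, hammingNorm_zero] at this
    omega
  refine ⟨hinj, ?_, ?_⟩
  · rw [IsTWeight, ← Finset.card_pair hne]
    congr 1
    ext i
    rw [Finset.mem_filter, weightCount_range hinj, Finset.card_ne_zero, Finset.mem_insert,
      Finset.mem_singleton, Finset.mem_Icc]
    constructor
    · rintro ⟨⟨hi, -⟩, x, hx⟩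
      rw [Finset.mem_filter] at hx
      have hx0 : x ≠ 0 := by
        rintro rfl
        rw [map_zero, hammingNorm_zero] at hx
        omega
      have := hpos (Units.mk0 x hx0)
      rw [Units.val_mk0, hx.2] at this
      exact this
    · have key (x : Lˣ) {w : ℕ} (hw : 0 < w) (hx : hammingNorm (Φ x) = w) : (1 ≤ w ∧ w ≤ n) ∧
          (Finset.univ.filter fun x => hammingNorm (Φ x) = w).Nonempty := by
        refine ⟨⟨hw, ?_⟩, x, by simpa using hx⟩
        rw [← hx]
        simpa using hammingNorm_le_card_fintype (x := Φ x)
      obtain ⟨x₁, hx₁⟩ := hE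
      obtain ⟨x₂, hx₂⟩ := hE'
      rintro (rfl | rfl)
      · exact key x₁ hw₁ (h₁ _ hx₁)
      · exact key x₂ hw₂ (h₂ _ (Finset.mem_compl.1 hx₂))
  · rw [weightEnumerator_range hinj, sum_eq_zero_add_sum_units, map_zero, hammingNorm_zero,
      pow_zero, ← Finset.sum_add_sum_compl E, ← add_assoc]
    congr 2
    · rw [Finset.sum_congr rfl (g := fun _ => X ^ w₁) (fun x hx => by rw [h₁ x hx]),
        Finset.sum_const, nsmul_eq_mul, map_natCast]
    · rw [Finset.sum_congr rfl (g := fun _ => X ^ w₂)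
        (fun x hx => by rw [h₂ x (Finset.mem_compl.1 hx)]), Finset.sum_const, nsmul_eq_mul,
        map_natCast]

end Enumerator

/-! ### Positivity of the weights. -/

/-- The exclusion of (m₁, m₂) = (2, 2) enters here: for k₁ = k₂ = 1 both sides equal q(q-1), and the
weight w₁ would vanish. -/
theorem sub_one_mul_pow_lt {q k₁ k₂ : ℕ} (hq : 2 ≤ q) (hk₂ : 0 < k₂)
    (h : 3 ≤ k₁ + k₂) :
    ((q : ℚ) - 1) * (q : ℚ) ^ k₂ < (q : ℚ) ^ k₁ * ((q : ℚ) ^ (2 * k₂) / q - 1) := by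
  obtain ⟨j, rfl⟩ : ∃ j, k₂ = j + 1 := ⟨k₂ - 1, by omega⟩
  have hq' : (2 : ℚ) ≤ q := by exact_mod_cast hq
  have h0 : (0 : ℚ) < (q : ℚ) ^ k₁ := by positivity
  have h1 : (q : ℚ) ^ (j + 1) < (q : ℚ) ^ (k₁ + 2 * j) :=
    pow_lt_pow_right₀ (by linarith) (by omega)
  have h2 : (1 : ℚ) ≤ (q : ℚ) ^ (2 * j) := one_le_pow₀ (by linarith)
  have h3 : (q : ℚ) ^ (2 * (j + 1)) / q = q * (q : ℚ) ^ (2 * j) := by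
    field_simp
    ring
  rw [h3]
  calc ((q : ℚ) - 1) * (q : ℚ) ^ (j + 1) < (q - 1) * (q : ℚ) ^ (k₁ + 2 * j) :=
        mul_lt_mul_of_pos_left h1 (by linarith)
    _ = (q : ℚ) ^ k₁ * ((q - 1) * (q : ℚ) ^ (2 * j)) := by rw [pow_add]; ring
    _ ≤ _ := mul_le_mul_of_nonneg_left (by linarith) h0.le

/-- The bound |θ| ≤ q covers both values θ = q and θ = -1 and makes the parity of k₁ + k₂
irrelevant. -/
theorem weight_numerator_pos {q k₁ k₂ : ℕ} (hq : 2 ≤ q) (hk₂ : 0 < k₂)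
    (h : 3 ≤ k₁ + k₂) {θ : ℚ} (hθ : |θ| ≤ q) :
    0 < ((q : ℚ) ^ (2 * k₁) - (q : ℚ) ^ (2 * k₁) / q) * ((q : ℚ) ^ (2 * k₂) / q - 1) -
      ((q - 1) * (-q : ℚ) ^ k₁ / q) * ((q - 1) * (-q : ℚ) ^ k₂ / q) * θ := by
  have hq' : (2 : ℚ) ≤ q := by exact_mod_cast hq
  have hq0 : (0 : ℚ) < q := by linarith
  have h1 := sub_one_mul_pow_lt hq hk₂ h
  rw [sub_pos]
  calc ((q - 1) * (-q : ℚ) ^ k₁ / q) * ((q - 1) * (-q : ℚ) ^ k₂ / q) * θ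
      ≤ |((q - 1) * (-q : ℚ) ^ k₁ / q) * ((q - 1) * (-q : ℚ) ^ k₂ / q) * θ| := le_abs_self _
    _ = ((q - 1) * (q : ℚ) ^ k₁ / q) * ((q - 1) * (q : ℚ) ^ k₂ / q) * |θ| := by
        simp only [abs_mul, abs_div, abs_pow, abs_neg, Nat.abs_cast,
          abs_of_nonneg (show (0 : ℚ) ≤ q - 1 by linarith)]
    _ ≤ ((q - 1) * (q : ℚ) ^ k₁ / q) * ((q - 1) * (q : ℚ) ^ k₂ / q) * q := by
        refine mul_le_mul_of_nonneg_left hθ (mul_nonneg ?_ ?_) <;>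
          exact div_nonneg (mul_nonneg (by linarith) (by positivity)) hq0.le
    _ = ((q - 1) * (q : ℚ) ^ k₁ / q) * ((q - 1) * (q : ℚ) ^ k₂) := by field_simp
    _ < ((q - 1) * (q : ℚ) ^ k₁ / q) * ((q : ℚ) ^ k₁ * ((q : ℚ) ^ (2 * k₂) / q - 1)) :=
        mul_lt_mul_of_pos_left h1 (div_pos (mul_pos (by linarith) (by positivity)) hq0)
    _ = _ := by field_simp; ring

open Classical in
theorem hammingNorm_add_card_zeros {F : Type*} [Field F] {n : ℕ} (c : Fin n → F) :
    hammingNorm c + (Finset.univ.filter fun i => c i = 0).card = n := by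
  have := Finset.card_filter_add_card_filter_not (s := (Finset.univ : Finset (Fin n)))
    (fun i => c i ≠ 0)
  simp only [not_not, Finset.card_univ, Fintype.card_fin] at this
  convert this using 2
  unfold hammingNorm
  congr!

theorem trace_mul_norm_algebraMap_mul_eq_zero_iff {F L K : Type*} [Field F] [Field L] [Field K]
    [Algebra F L] [Algebra F K] [Algebra L K] [IsScalarTower F L K] (x : L) {u : F} (hu : u ≠ 0)
    (y : K) : Algebra.trace F L (x * Algebra.norm L (algebraMap F K u * y)) = 0 ↔
      Algebra.trace F L (x * Algebra.norm L y) = 0 := by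
  have : x * Algebra.norm L (algebraMap F K u * y) =
      u ^ Module.finrank L K • (x * Algebra.norm L y) := by
    rw [map_mul, IsScalarTower.algebraMap_apply F L K, Algebra.norm_algebraMap, Algebra.smul_def,
      map_pow]
    ring
  rw [this, map_smul, smul_eq_zero, or_iff_right (pow_ne_zero _ hu)]

theorem zero_notMem_definingSet {F L₂ K : Type*} [Field F] [Field L₂] [Field K] [Algebra F L₂]
    [Algebra L₂ K] (a : F) : (0 : K) ∉ definingSet F L₂ K a := fun h => h.1 rfl

/-! ### Length and weights of the shortened code. -/

section Main

variable {F L₁ L₂ K : Type*} [Field F] [Fintype F] [Field L₁] [Fintype L₁] [Field L₂] [Fintype L₂]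
  [Field K] [Fintype K] [Algebra F L₁] [Algebra F L₂] [Algebra F K] [Algebra L₁ K] [Algebra L₂ K]
  [IsScalarTower F L₁ K]

open Classical in
/-- The length of the shortened code. -/
theorem IsShortenedSet.card_eq {D₁ : Set K} (hD₁ : IsShortenedSet F (definingSet F L₂ K 0) D₁)
    {n : ℕ} {d : Fin n → K} (hd : Function.Injective d) (hrange : Set.range d = D₁) {k₂ : ℕ}
    (hL₂ : Module.finrank F L₂ = 2 * k₂) :
    (Nat.card L₂ˣ : ℚ) * (((Fintype.card F : ℚ) - 1) * n) =
      Nat.card Kˣ * ((Fintype.card F : ℚ) ^ (2 * k₂) / Fintype.card F - 1) := by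
  have h1 := hD₁.card_filter_eq (zero_notMem_definingSet 0) hd hrange (fun _ => True) (by simp)
  have h2 := MonoidHom.sum_comp_eq_of_surjective (R := ℚ) (Units.map (Algebra.norm L₂) : Kˣ →* L₂ˣ)
    (FiniteField.unitsMap_norm_surjective L₂ K) fun v : L₂ˣ =>
      if Algebra.trace F L₂ (v : L₂) = 0 then 1 else 0
  have h3 := FiniteField.card_mul_card_units_trace_eq_zero F L₂
  rw [Module.card_eq_pow_finrank (K := F) (V := L₂), hL₂] at h3
  have hF : (Fintype.card F : ℚ) ≠ 0 := by simp
  have h4 : ((Finset.univ.filter fun v : L₂ˣ => Algebra.trace F L₂ (v : L₂) = 0).card : ℚ) =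
      (Fintype.card F : ℚ) ^ (2 * k₂) / Fintype.card F - 1 := by
    rw [eq_sub_iff_add_eq, eq_div_iff hF, mul_comm]
    exact_mod_cast h3
  have h5 : ((((Fintype.card F - 1) * n : ℕ)) : ℚ) =
      ∑ y : Kˣ, if Algebra.trace F L₂ ((Units.map (Algebra.norm L₂) y : L₂ˣ) : L₂) = 0
        then 1 else 0 := by
    rw [Finset.filter_true, Finset.card_univ, Fintype.card_fin] at h1
    rw [← h1, Finset.card_filter]
    push_cast
    exact Finset.sum_congr rfl fun y _ => if_congr (by simp [definingSet]) rfl rfl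
  rw [← h4, ← Finset.sum_boole, ← h2, ← h5, Nat.cast_mul, Nat.cast_sub Fintype.card_pos,
    Nat.cast_one]

open Classical in
/-- The weights of the codewords of the shortened code. -/
theorem IsShortenedSet.exists_hammingNorm_eq {D₁ : Set K}
    (hD₁ : IsShortenedSet F (definingSet F L₂ K 0) D₁)
    {n : ℕ} {d : Fin n → K} (hd : Function.Injective d) (hrange : Set.range d = D₁) {k₁ k₂ : ℕ}
    (hL₁ : Module.finrank F L₁ = 2 * k₁) (hL₂ : Module.finrank F L₂ = 2 * k₂)
    (hk : k₁.Coprime k₂) :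
    ∃ E : Finset L₁ˣ, (Fintype.card F + 1) * E.card = Nat.card L₁ˣ ∧ ∀ x : L₁ˣ,
      (Nat.card L₁ˣ : ℚ) * Nat.card L₂ˣ * ((Fintype.card F - 1) *
        hammingNorm fun i => Algebra.trace F L₁ (x * Algebra.norm L₁ (d i))) =
      Nat.card Kˣ * (((Fintype.card F : ℚ) ^ (2 * k₁) -
          (Fintype.card F : ℚ) ^ (2 * k₁) / Fintype.card F) *
          ((Fintype.card F : ℚ) ^ (2 * k₂) / Fintype.card F - 1) -
        ((Fintype.card F - 1) * (-Fintype.card F : ℚ) ^ k₁ / Fintype.card F) *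
          ((Fintype.card F - 1) * (-Fintype.card F : ℚ) ^ k₂ / Fintype.card F) *
          if x ∈ E then (Fintype.card F : ℚ) else -1) := by
  obtain ⟨E, hE, hx⟩ := FiniteField.exists_card_trace_norm_eq_zero hL₁ hL₂ hk K
  refine ⟨E, hE, fun x => ?_⟩
  have h1 := hD₁.card_eq hd hrange hL₂
  have h2 := hD₁.card_filter_eq (zero_notMem_definingSet 0) hd hrange
    (fun y => Algebra.trace F L₁ (x * Algebra.norm L₁ y) = 0)
    (fun u y hu => trace_mul_norm_algebraMap_mul_eq_zero_iff _ hu y)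
  have h3 : (Finset.univ.filter fun y : Kˣ => (y : K) ∈ definingSet F L₂ K 0 ∧
      Algebra.trace F L₁ (x * Algebra.norm L₁ (y : K)) = 0) = Finset.univ.filter fun y : Kˣ =>
        Algebra.trace F L₂ (Algebra.norm L₂ (y : K)) = 0 ∧
          Algebra.trace F L₁ (x * Algebra.norm L₁ (y : K)) = 0 := by
    ext y
    simp [definingSet]
  have h4 := hx x
  rw [← h3, h2] at h4
  have h5 := hammingNorm_add_card_zeros
    fun i => Algebra.trace F L₁ (x * Algebra.norm L₁ (d i))
  have h6 : (Nat.card L₁ˣ : ℚ) = (Fintype.card F : ℚ) ^ (2 * k₁) - 1 := by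
    rw [Nat.card_units, Nat.card_eq_fintype_card, Module.card_eq_pow_finrank (K := F) (V := L₁),
      hL₁, Nat.cast_sub (Nat.one_le_pow _ _ Fintype.card_pos)]
    simp
  have h7 : 1 ≤ Fintype.card F := Fintype.card_pos
  have h8 := congrArg (Nat.cast (R := ℚ)) h5
  push_cast [Nat.cast_sub h7] at h4 h8
  rw [← h8] at h1
  linear_combination (Nat.card L₁ˣ : ℚ) * h1 - h4 +
    (Nat.card Kˣ : ℚ) * ((Fintype.card F : ℚ) ^ (2 * k₂) / Fintype.card F - 1) * h6

end Main

/-! ### Closed formulas and the final theorem. -/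

/-- The parameters (e, j) treat both weights at once: (0, 0) encodes θ = q and (1, 1) encodes θ =
-1. The exponent of q can be negative, hence the integer power. -/
theorem weight_formula_eq {q m m₁ m₂ k₁ k₂ : ℕ} (hq : 2 ≤ q) (hk₁ : 0 < k₁) (hk₂ : 0 < k₂)
    (h₁ : m₁ = 2 * k₁) (h₂ : m₂ = 2 * k₂) {w : ℚ} (e j : ℕ)
    (hw : ((q : ℚ) ^ m₁ - 1) * ((q : ℚ) ^ m₂ - 1) * ((q - 1) * w) =
      ((q : ℚ) ^ m - 1) * (((q : ℚ) ^ (2 * k₁) - (q : ℚ) ^ (2 * k₁) / q) *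
        ((q : ℚ) ^ (2 * k₂) / q - 1) - ((q - 1) * (-q : ℚ) ^ k₁ / q) *
          ((q - 1) * (-q : ℚ) ^ k₂ / q) * ((-1) ^ e * (q / (q : ℚ) ^ j)))) :
    w = (q : ℚ) ^ (m₁ - 1) * ((q : ℚ) ^ m - 1) *
          ((q : ℚ) ^ (m₂ - 1) - 1 -
            (-1) ^ ((m₁ + m₂) / 2 + e) * ((q : ℚ) - 1) *
              (q : ℚ) ^ (((m₂ : ℤ) - (m₁ : ℤ)) / 2 - j)) /
          (((q : ℚ) ^ m₁ - 1) * ((q : ℚ) ^ m₂ - 1)) := by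
  have hq' : (2 : ℚ) ≤ q := by exact_mod_cast hq
  have hq0 : (q : ℚ) ≠ 0 := by linarith
  have hone (k : ℕ) (hk : 0 < k) : (q : ℚ) ^ (2 * k) - 1 ≠ 0 :=
    (sub_pos.2 (one_lt_pow₀ (by linarith) (by omega))).ne'
  have hpred (k : ℕ) (hk : 0 < k) : (q : ℚ) ^ (2 * k - 1) = (q : ℚ) ^ (2 * k) / q := by
    rw [eq_div_iff hq0, ← pow_succ, Nat.sub_add_cancel (by omega)]
  have hz : (q : ℚ) ^ (((m₂ : ℤ) - (m₁ : ℤ)) / 2 - j) = (q : ℚ) ^ k₂ / (q : ℚ) ^ k₁ / (q : ℚ) ^ j := by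
    rw [show ((m₂ : ℤ) - (m₁ : ℤ)) / 2 = (k₂ : ℤ) - k₁ by omega, zpow_sub₀ hq0, zpow_sub₀ hq0,
      zpow_natCast, zpow_natCast, zpow_natCast]
  have hhalf : (m₁ + m₂) / 2 = k₁ + k₂ := by omega
  rw [hz, hhalf]
  subst h₁ h₂
  rw [hpred k₁ hk₁, hpred k₂ hk₂, eq_div_iff (mul_ne_zero (hone k₁ hk₁) (hone k₂ hk₂)),
    ← mul_right_inj' (show (q : ℚ) - 1 ≠ 0 by linarith)]
  refine Eq.trans (by ring) (hw.trans ?_)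
  rw [neg_pow (q : ℚ) k₁, neg_pow (q : ℚ) k₂, pow_mul' _ 2 k₁, pow_add, pow_add]
  field_simp

theorem natCast_card_units_eq (F : Type*) {V : Type*} [Field F] [Fintype F] [Field V] [Fintype V]
    [Algebra F V] :
    (Nat.card Vˣ : ℚ) = (Fintype.card F : ℚ) ^ Module.finrank F V - 1 := by
  rw [Nat.card_units, Nat.card_eq_fintype_card, Module.card_eq_pow_finrank (K := F) (V := V),
    Nat.cast_sub (Nat.one_le_pow _ _ Fintype.card_pos)]
  simp

end

theorem corollary4p10 {F L₁ L₂ K : Type*} [Field F] [Fintype F] [Field L₁] [Field L₂] [Field K]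
    [Algebra F L₁] [Algebra F L₂] [Algebra F K] [Algebra L₁ K] [Algebra L₂ K]
    [IsScalarTower F L₁ K] [IsScalarTower F L₂ K]
    (q m m₁ m₂ : ℕ) (hq : Fintype.card F = q)
    (hm : 0 < m) (hm₁ : 0 < m₁) (hm₂ : 1 < m₂) (hdvd₁ : m₁ ∣ m) (hdvd₂ : m₂ ∣ m)
    (hK : Module.finrank F K = m) (hL₁ : Module.finrank F L₁ = m₁)
    (hL₂ : Module.finrank F L₂ = m₂)
    (he : Nat.gcd m₁ m₂ = 2) (hne : (m₁, m₂) ≠ (2, 2))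
    (D₁ : Set K) (hD₁ : IsShortenedSet F (definingSet F L₂ K 0) D₁)
    (n : ℕ) (d : Fin n → K) (hd : Function.Injective d) (hrange : Set.range d = D₁) :
    (n : ℚ) = ((q : ℚ) ^ m - 1) * ((q : ℚ) ^ (m₂ - 1) - 1) /
        (((q : ℚ) ^ m₂ - 1) * ((q : ℚ) - 1)) ∧
    Module.finrank F (traceNormCode F L₁ d) = m₁ ∧
    IsTWeight 2 (traceNormCode F L₁ d) ∧
    ∃ w₁ w₂ : ℕ,
      (w₁ : ℚ) = (q : ℚ) ^ (m₁ - 1) * ((q : ℚ) ^ m - 1) *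
          ((q : ℚ) ^ (m₂ - 1) - 1 -
            (-1) ^ ((m₁ + m₂) / 2) * ((q : ℚ) - 1) * (q : ℚ) ^ (((m₂ : ℤ) - (m₁ : ℤ)) / 2)) /
          (((q : ℚ) ^ m₁ - 1) * ((q : ℚ) ^ m₂ - 1)) ∧
      (w₂ : ℚ) = (q : ℚ) ^ (m₁ - 1) * ((q : ℚ) ^ m - 1) *
          ((q : ℚ) ^ (m₂ - 1) - 1 -
            (-1) ^ ((m₁ + m₂) / 2 + 1) * ((q : ℚ) - 1) *
              (q : ℚ) ^ (((m₂ : ℤ) - (m₁ : ℤ)) / 2 - 1)) /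
          (((q : ℚ) ^ m₁ - 1) * ((q : ℚ) ^ m₂ - 1)) ∧
      weightEnumerator (traceNormCode F L₁ d) =
        1 + Polynomial.C (((q : ℚ) ^ m₁ - 1) / ((q : ℚ) + 1)) * Polynomial.X ^ w₁ +
          Polynomial.C ((q : ℚ) * ((q : ℚ) ^ m₁ - 1) / ((q : ℚ) + 1)) * Polynomial.X ^ w₂ := by
  classical
  have hFK : FiniteDimensional F K := Module.finite_of_finrank_pos (hK ▸ hm)
  have : FiniteDimensional F L₁ := Module.finite_of_finrank_pos (hL₁ ▸ hm₁)
  have : FiniteDimensional F L₂ := Module.finite_of_finrank_pos (by omega)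
  have := Module.finite_of_finite F (M := K)
  have := Module.finite_of_finite F (M := L₁)
  have := Module.finite_of_finite F (M := L₂)
  let _ := Fintype.ofFinite K
  let _ := Fintype.ofFinite L₁
  let _ := Fintype.ofFinite L₂
  obtain ⟨k₁, hk₁⟩ : 2 ∣ m₁ := he ▸ Nat.gcd_dvd_left m₁ m₂
  obtain ⟨k₂, hk₂⟩ : 2 ∣ m₂ := he ▸ Nat.gcd_dvd_right m₁ m₂
  have hk : k₁.Coprime k₂ := by
    rw [hk₁, hk₂, Nat.gcd_mul_left] at he
    exact Nat.eq_of_mul_eq_mul_left two_pos (he.trans (mul_one 2).symm)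
  have hk₁0 : 0 < k₁ := by omega
  have hk₂0 : 0 < k₂ := by omega
  have hk3 : 3 ≤ k₁ + k₂ := by
    by_contra! h
    exact hne (by rw [hk₁, hk₂]; congr <;> omega)
  have hq2 : 2 ≤ q := hq ▸ Fintype.one_lt_card
  have hq' : (2 : ℚ) ≤ q := by exact_mod_cast hq2
  have hone (k : ℕ) (hk : 0 < k) : 0 < (q : ℚ) ^ k - 1 :=
    sub_pos.2 (one_lt_pow₀ (by linarith) (by omega))
  have hlen := hD₁.card_eq hd hrange (hL₂.trans hk₂)
  obtain ⟨E, hE, hwt⟩ :=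
    hD₁.exists_hammingNorm_eq hd hrange (hL₁.trans hk₁) (hL₂.trans hk₂) hk
  simp only [natCast_card_units_eq F, hK, hL₁, hL₂, hq] at hlen hwt
  have hden : 0 < ((q : ℚ) ^ m₁ - 1) * ((q : ℚ) ^ m₂ - 1) :=
    mul_pos (hone _ hm₁) (hone _ (by omega))
  have hq1 : (0 : ℚ) < q - 1 := by linarith
  have hG := hone m hm
  have hE₁ : E.Nonempty := by
    rw [Finset.nonempty_iff_ne_empty]
    rintro rfl
    exact Nat.card_pos.ne' (hE.symm.trans (by simp))
  have hE₂ : Eᶜ.Nonempty := by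
    rw [Finset.nonempty_iff_ne_empty]
    intro h
    rw [Finset.compl_eq_empty_iff] at h
    rw [h, Finset.card_univ, ← Nat.card_eq_fintype_card (α := L₁ˣ)] at hE
    have : 0 < Nat.card L₁ˣ := Nat.card_pos
    nlinarith
  obtain ⟨x₁, hx₁⟩ := hE₁
  obtain ⟨x₂, hx₂⟩ := hE₂
  rw [Finset.mem_compl] at hx₂
  set wt : L₁ˣ → ℕ := fun x =>
    hammingNorm fun i => Algebra.trace F L₁ (x * Algebra.norm L₁ (d i))
  have hwt₁ := hwt x₁
  have hwt₂ := hwt x₂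
  rw [if_pos hx₁] at hwt₁
  rw [if_neg hx₂] at hwt₂
  have hpos₁ := weight_numerator_pos hq2 hk₂0 hk3 (θ := q) (by simp)
  have hpos₂ := weight_numerator_pos hq2 hk₂0 hk3 (θ := -1) (by simp; linarith)
  have hcongr (x y : L₁ˣ) (hxy : x ∈ E ↔ y ∈ E) : wt x = wt y := by
    have h := hwt x
    simp only [hxy] at h
    rw [← hwt y] at h
    exact_mod_cast mul_left_cancel₀ hq1.ne' (mul_left_cancel₀ hden.ne' h)
  have hwpos {w : ℕ} {c : ℚ} (hc : 0 < c) (h : ((q : ℚ) ^ m₁ - 1) * ((q : ℚ) ^ m₂ - 1) *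
      ((q - 1) * w) = ((q : ℚ) ^ m - 1) * c) : 0 < w := by
    rw [Nat.pos_iff_ne_zero]
    rintro rfl
    exact (mul_pos hG hc).ne' (by rw [← h]; simp)
  -- The two numerators differ only in θ, whose coefficient is nonzero, so equal weights would give
  -- q = -1.
  have hne' : wt x₁ ≠ wt x₂ := by
    intro h
    have h' : hammingNorm (fun i => Algebra.trace F L₁ (x₁ * Algebra.norm L₁ (d i))) =
      hammingNorm (fun i => Algebra.trace F L₁ (x₂ * Algebra.norm L₁ (d i))) := h
    rw [h', hwt₂] at hwt₁
    have h1 := mul_left_cancel₀ hG.ne' hwt₁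
    have hβ (k : ℕ) : ((q : ℚ) - 1) * (-q : ℚ) ^ k / q ≠ 0 :=
      div_ne_zero (mul_ne_zero hq1.ne' (pow_ne_zero _ (by linarith))) (by linarith)
    have h2 := mul_left_cancel₀ (mul_ne_zero (hβ k₁) (hβ k₂)) (sub_right_injective h1)
    linarith
  obtain ⟨hinj, htwo, henum⟩ := two_weight_of_hammingNorm (E := E) (w₁ := wt x₁) (w₂ := wt x₂)
    (Φ := LinearMap.pi fun i =>
      (Algebra.trace F L₁).comp (LinearMap.mulRight F (Algebra.norm L₁ (d i))))
    ⟨x₁, hx₁⟩ ⟨x₂, Finset.mem_compl.2 hx₂⟩ (hwpos hpos₁ hwt₁) (hwpos hpos₂ hwt₂) hne'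
    (fun x hx => hcongr x x₁ (by simp [hx, hx₁])) (fun x hx => hcongr x x₂ (by simp [hx, hx₂]))
  refine ⟨?_, ?_, htwo, wt x₁, wt x₂, ?_, ?_, ?_⟩
  · rw [eq_div_iff (mul_pos (hone _ (by omega)) hq1).ne']
    have hpow : (q : ℚ) ^ (m₂ - 1) = (q : ℚ) ^ (2 * k₂) / q := by
      rw [eq_div_iff (by linarith), ← pow_succ, Nat.sub_add_cancel (by omega), hk₂]
    rw [hpow, ← hlen]
    ring
  · rw [← hL₁]
    exact LinearMap.finrank_range_of_inj hinj
  · have := weight_formula_eq (m := m) hq2 hk₁0 hk₂0 hk₁ hk₂ 0 0 (w := wt x₁) (by simpa using hwt₁)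
    simpa using this
  · have h : (-1 : ℚ) ^ 1 * (q / (q : ℚ) ^ 1) = -1 := by
      field_simp
    exact weight_formula_eq (m := m) hq2 hk₁0 hk₂0 hk₁ hk₂ 1 1 (by rw [h]; exact hwt₂)
  · have hEc : ((q : ℚ) + 1) * E.card = (q : ℚ) ^ m₁ - 1 := by
      rw [← hL₁, ← hq, ← natCast_card_units_eq F, ← hE]
      push_cast
      ring
    have hEc' : (E.card : ℚ) + Eᶜ.card = (q : ℚ) ^ m₁ - 1 := by
      rw [← hL₁, ← hq, ← natCast_card_units_eq F, Nat.card_eq_fintype_card,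
        ← Finset.card_add_card_compl E]
      push_cast
      ring
    have h1 : ((q : ℚ) ^ m₁ - 1) / (q + 1) = E.card := by
      rw [div_eq_iff (by linarith), ← hEc, mul_comm]
    have h2 : (q : ℚ) * ((q : ℚ) ^ m₁ - 1) / (q + 1) = Eᶜ.card := by
      rw [div_eq_iff (by linarith)]
      linear_combination hEc - (q + 1 : ℚ) * hEc'
    rw [h1, h2]
    exact henum
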